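/- \textbf{Caching in Matchings.} Let $n\ge 0$ and $k\ge 1$ be integers and let $V^{in},V^{out}$ be two disjoint sets of $n$ nodes each. A cache consists of $k$ matchings $M_1,\dots,M_k\subseteq V^{in}\times V^{out}$ (the colors); all of them are empty at the start. Requests $\sigma=(\sigma_1,\sigma_2,\dots,\sigma_m)$, $\sigma_i\in V^{in}\times V^{out}$, arrive one by one, and $\sigma_i$ must be in one of the matchings when it is served. At any time any edges may be evicted from the matchings, for free, and any edges may be added to them, provided that each $M_c$ remains a matching; every addition of an edge to a matching costs $1$ (so moving an edge from one matching to another, that is, evicting and re-fetching it, costs $1$). Let $OPT(\sigma)$ be the minimum cost of serving $\sigma$ when all of $\sigma$ is known in advance. An online algorithm decides how to serve $\sigma_i$ knowing only $\sigma_1,\dots,\sigma_i$; a randomized online algorithm is a random deterministic one. A deterministic (randomized) online algorithm $A$ is $c$-competitive if there is a constant $d$, which may depend on $n$ and $k$ but not on $\sigma$, such that its cost (its expected cost) on every finite request sequence $\sigma$ is at most $c\cdot OPT(\sigma)+d$. \textbf{Theorem.} (1) For all $n\ge 0$ and $k\ge 1$ there is an $nk$-competitive deterministic online algorithm for Caching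 in Matchings with $k$ matchings on the bipartite graph with $n$ nodes per side. (2) There is an absolute constant $C>0$ such that for all $n\ge 0$ and $k\ge 2$ there is a $(C\,n\log_2 k)$-competitive randomized online algorithm for this problem. -/

import Mathlib

namespace CachingInMatchings

/-- The edges of the complete bipartite graph with `n` nodes on each side: the pair `(u, v)` joins
the node `u` of the first side to the node `v` of the second side. Requests are such edges. -/
abbrev Edge (n : ℕ) : Type := Fin n × Fin n

/-- A set of edges is a matching if two of its edges that share an endpoint are equal. -/
def IsMatching {n : ℕ} (s : Finset (Edge n)) : Prop :=
  ∀ e ∈ s, ∀ f ∈ s, (e.1 = f.1 ∨ e.2 = f.2) → e = f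

/-- A cache configuration: `k` matchings, indexed by the colors `Fin k`. -/
@[ext]
structure Cache (n k : ℕ) where
  /-- the edges stored with a given color -/
  edges : Fin k → Finset (Edge n)
  /-- every color class is a matching -/
  isMatching : ∀ c, IsMatching (edges c)

namespace Cache

variable {n k : ℕ}

/-- The empty cache. -/
def empty (n k : ℕ) : Cache n k where
  edges := fun _ => ∅
  isMatching := fun _ e he => absurd he (Finset.notMem_empty e)

/-- The edge `e` is cached if it lies in one of the matchings. -/
def Holds (M : Cache n k) (e : Edge n) : Prop :=
  ∃ c, e ∈ M.edges c

/-- The cost of changing the cache from `M` to `M'`: evictions are free, every edge added to a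
matching costs `1`. An edge that changes its color is evicted and fetched again, hence it is
charged. -/
def fetchCost (M M' : Cache n k) : ℕ :=
  ∑ c, (M'.edges c \ M.edges c).card

end Cache

variable {n k : ℕ}

/-- The cost of the first `m` transitions of a sequence of caches. -/
def scheduleCost (S : ℕ → Cache n k) (m : ℕ) : ℕ :=
  ∑ i ∈ Finset.range m, (S i).fetchCost (S (i + 1))

/-- The sequence of caches `S` serves the request sequence `σ`: it starts from the empty cache, and
`S (i + 1)`, the cache when the request `σ[i]` is served, contains that request. All changes made
since the previous request was served are accounted for in the transition from `S i` to
`S (i + 1)`; they are arbitrary, so edges other than the requested one may be added. -/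
def Serves (S : ℕ → Cache n k) (σ : List (Edge n)) : Prop :=
  S 0 = Cache.empty n k ∧ ∀ (i : ℕ) (hi : i < σ.length), (S (i + 1)).Holds σ[i]

/-- The optimal offline cost of serving `σ` with `k` matchings. -/
noncomputable def optCost (k : ℕ) (σ : List (Edge n)) : ℕ :=
  sInf {x | ∃ S : ℕ → Cache n k, Serves S σ ∧ scheduleCost S σ.length = x}

/-- A deterministic online algorithm: the cache when a request is served is a function of the
requests that have arrived up to and including that one, and it contains that request. -/
structure OnlineAlgorithm (n k : ℕ) where
  /-- the cache when the last request of a request sequence is served -/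
  cache : List (Edge n) → Cache n k
  cache_nil : cache [] = Cache.empty n k
  holds_request : ∀ (σ : List (Edge n)) (e : Edge n), (cache (σ ++ [e])).Holds e

/-- The cost of a deterministic online algorithm on the request sequence `σ`. -/
def OnlineAlgorithm.cost (A : OnlineAlgorithm n k) (σ : List (Edge n)) : ℕ :=
  scheduleCost (fun i => A.cache (σ.take i)) σ.length

/-- A deterministic online algorithm is `c`-competitive if its cost is at most `c` times the
optimal offline cost, up to an additive constant that does not depend on the requests. -/
def OnlineAlgorithm.IsCompetitive (A : OnlineAlgorithm n k) (c : ℝ) : Prop :=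
  ∃ d : ℝ, ∀ σ : List (Edge n), (A.cost σ : ℝ) ≤ c * (optCost k σ : ℝ) + d

/-- A randomized online algorithm: a random deterministic online algorithm, given on some
probability space, whose cache after any fixed request sequence is a random variable. -/
structure RandomizedAlgorithm (n k : ℕ) where
  /-- the space of random choices -/
  Ω : Type
  measurableSpace : MeasurableSpace Ω
  /-- the distribution of the random choices -/
  μ : MeasureTheory.Measure Ω
  isProbabilityMeasure : MeasureTheory.IsProbabilityMeasure μ
  /-- the deterministic algorithm that is run for a given outcome -/
  alg : Ω → OnlineAlgorithm n k
  measurableSet_cache_eq : ∀ (σ : List (Edge n)) (M : Cache n k),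
    MeasurableSet {ω | (alg ω).cache σ = M}

/-- The expected cost of a randomized online algorithm on a fixed request sequence. (There are
finitely many caches, so the cost is a bounded random variable.) -/
noncomputable def RandomizedAlgorithm.expectedCost (R : RandomizedAlgorithm n k)
    (σ : List (Edge n)) : ℝ :=
  letI := R.measurableSpace
  MeasureTheory.integral R.μ (fun ω => ((R.alg ω).cost σ : ℝ))

/-- A randomized online algorithm is `c`-competitive (against an oblivious adversary) if its
expected cost is at most `c` times the optimal offline cost, up to an additive constant that does
not depend on the requests. -/
def RandomizedAlgorithm.IsCompetitive (R : RandomizedAlgorithm n k) (c : ℝ) : Prop :=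
  ∃ d : ℝ, ∀ σ : List (Edge n), R.expectedCost σ ≤ c * (optCost k σ : ℝ) + d

end CachingInMatchings

/-! A bipartite graph of maximal degree at most `k` is a union of `k` matchings, so the task splits
in two: choose online a graph of degree at most `k`, and keep it properly colored. If an edge joins
two nodes that have a free color each, a two-color Kempe chain makes room for it. There are two ways
to do the exchange, they recolor disjoint sets of edges, and one of them recolors fewer than `n`
(`IsProper.exists_insert`). Hence a graph algorithm costs at most `n` per fault
(`GraphAlgorithm.cost_toOnline_le`), and it remains to bound faults against offline fetches. Of the
offline caches only the degree bound and the number of newly stored edges are used.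

Deterministic choice: loaded edges are marked, and when all `k` edges at a full node are marked they
are unmarked. With `M` the marked edges and `H` the offline edges, the potential `k * |M ∪ H| - |M|`
pays for every fault, and an offline fetch raises it by at most `k` (`exists_markingStep`).

Randomized choice: every node runs the randomized marking algorithm for paging on its incident
edges, and an edge stays cached while both endpoints keep it. A fault is a miss at some endpoint.
The phases do not depend on the random order, so a single order serves all nodes and phases, and
expectations add up whatever the correlations. At a node the expected misses are at most `1 +
harmonic k` times the new requests (`missCount_add_le`), and these number at most twice the offline
fetches there (`offlinePotential_pagingStep_add_le`). Each fetch is seen by two nodes, which gives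
the factor `4 * (1 + harmonic k)`. -/

namespace CachingInMatchings

/-! ### Edge colorings and Kempe chains -/

variable {n k : ℕ}

/-- The coloring `col` of the edges is proper on the set `G` of edges. -/
def IsProper (G : Finset (Edge n)) (col : Edge n → Fin k) : Prop :=
  ∀ x ∈ G, ∀ y ∈ G, (x.1 = y.1 ∨ x.2 = y.2) → col x = col y → x = y

theorem IsProper.mono {G G' : Finset (Edge n)} {col : Edge n → Fin k} (h : IsProper G col)
    (hG : G' ⊆ G) : IsProper G' col :=
  fun x hx y hy => h x (hG hx) y (hG hy)

theorem IsProper.update {G : Finset (Edge n)} {col : Edge n → Fin k} (h : IsProper G col)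
    {e : Edge n} (he : e ∉ G) {c : Fin k}
    (hc : ∀ x ∈ G, (x.1 = e.1 ∨ x.2 = e.2) → col x ≠ c) :
    IsProper (insert e G) (Function.update col e c) := by
  have hne : ∀ x ∈ G, x ≠ e := fun x hx hxe => he (hxe ▸ hx)
  intro x hx y hy hxy hcol
  rcases Finset.mem_insert.1 hx with rfl | hx' <;> rcases Finset.mem_insert.1 hy with rfl | hy'
  · rfl
  · rw [Function.update_self, Function.update_of_ne (hne y hy')] at hcol
    exact absurd hcol.symm (hc y hy' (hxy.imp Eq.symm Eq.symm))
  · rw [Function.update_self, Function.update_of_ne (hne x hx')] at hcol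
    exact absurd hcol (hc x hx' hxy)
  · rw [Function.update_of_ne (hne x hx'), Function.update_of_ne (hne y hy')] at hcol
    exact h x hx' y hy' hxy hcol

open Classical in
/-- Exchange the colors `a` and `b` on the edges whose first endpoint is in `T`. -/
noncomputable def swapOn (col : Edge n → Fin k) (a b : Fin k) (T : Set (Fin n)) :
    Edge n → Fin k :=
  fun x => if x.1 ∈ T then Equiv.swap a b (col x) else col x

/-- Edges with a common first endpoint are either both swapped or both kept, so a conflict can only
arise at a second endpoint, between an edge of color `a` and one of color `b`. The hypothesis says
that `T` never separates such a pair. -/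
theorem IsProper.swap_colors {G : Finset (Edge n)} {col : Edge n → Fin k} (h : IsProper G col)
    {a b : Fin k} {T : Set (Fin n)}
    (hT : ∀ x ∈ G, ∀ y ∈ G, x.2 = y.2 → col x = a → col y = b → (x.1 ∈ T ↔ y.1 ∈ T)) :
    IsProper G (swapOn col a b T) := by
  have key : ∀ x ∈ G, ∀ y ∈ G, x.2 = y.2 → x.1 ∈ T → y.1 ∉ T →
      Equiv.swap a b (col x) = col y → x = y := by
    intro x hx y hy hxy hxT hyT hcol
    by_cases ha : col x = a
    · rw [ha, Equiv.swap_apply_left] at hcol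
      exact absurd ((hT x hx y hy hxy ha hcol.symm).1 hxT) hyT
    by_cases hb : col x = b
    · rw [hb, Equiv.swap_apply_right] at hcol
      exact absurd ((hT y hy x hx hxy.symm hcol.symm hb).2 hxT) hyT
    · rw [Equiv.swap_apply_of_ne_of_ne ha hb] at hcol
      exact h x hx y hy (Or.inr hxy) hcol
  intro x hx y hy hxy hcol
  unfold swapOn at hcol
  split_ifs at hcol with h1 h2 h2
  · exact h x hx y hy hxy ((Equiv.swap a b).injective hcol)
  · rcases hxy with hxy | hxy
    · exact absurd (hxy ▸ h1) h2
    · exact key x hx y hy hxy h1 h2 hcol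
  · rcases hxy with hxy | hxy
    · exact absurd (hxy ▸ h2) h1
    · exact (key y hy x hx hxy.symm h2 h1 hcol.symm).symm
  · exact h x hx y hy hxy hcol

/-- A proper coloring can be extended to one more edge, if its endpoints have degree less than
`k`, by changing the colors of less than `n` edges. -/
theorem IsProper.exists_insert {G : Finset (Edge n)} {col : Edge n → Fin k} (h : IsProper G col)
    {e : Edge n} (he : e ∉ G) (h1 : (G.filter (fun x => x.1 = e.1)).card < k)
    (h2 : (G.filter (fun x => x.2 = e.2)).card < k) :
    ∃ col' : Edge n → Fin k, IsProper (insert e G) col' ∧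
      (G.filter (fun x => col' x ≠ col x)).card < n := by
  have free : ∀ F : Finset (Edge n), F.card < k → ∃ c : Fin k, ∀ x ∈ F, col x ≠ c := by
    intro F hF
    have : (F.image col).card < (Finset.univ : Finset (Fin k)).card := by
      rw [Finset.card_univ, Fintype.card_fin]
      exact Finset.card_image_le.trans_lt hF
    obtain ⟨c, -, hc⟩ := Finset.exists_mem_notMem_of_card_lt_card this
    exact ⟨c, fun x hx hxc => hc (Finset.mem_image.2 ⟨x, hx, hxc⟩)⟩
  obtain ⟨a, ha⟩ := free _ h1
  obtain ⟨b, hb⟩ := free _ h2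
  replace ha : ∀ x ∈ G, x.1 = e.1 → col x ≠ a :=
    fun x hx hxe => ha x (Finset.mem_filter.2 ⟨hx, hxe⟩)
  replace hb : ∀ x ∈ G, x.2 = e.2 → col x ≠ b :=
    fun x hx hxe => hb x (Finset.mem_filter.2 ⟨hx, hxe⟩)
  -- Two steps of an alternating path: out along color `b`, back along color `a`. Thus `S` is the
  -- first side of the chain that starts at `e.1`.
  let r : Fin n → Fin n → Prop := fun x x' =>
    ∃ y, (x, y) ∈ G ∧ col (x, y) = b ∧ (x', y) ∈ G ∧ col (x', y) = a
  let S : Set (Fin n) := {x | Relation.ReflTransGen r e.1 x}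
  have heS : e.1 ∈ S := Relation.ReflTransGen.refl
  -- an edge of color `a` at a node of `S` meets an edge of color `b` at a node of `S`
  have back : ∀ x ∈ G, col x = a → x.1 ∈ S → ∃ z ∈ G, col z = b ∧ z.2 = x.2 ∧ z.1 ∈ S := by
    intro x hx hxa hxS
    rcases Relation.ReflTransGen.cases_tail hxS with hxe | ⟨w, hw, y, hwy, hwb, hxy, hya⟩
    · exact absurd hxa (ha x hx hxe)
    · have : x = (x.1, y) := h x hx _ hxy (Or.inl rfl) (hxa.trans hya.symm)
      exact ⟨(w, y), hwy, hwb, by rw [this], hw⟩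
  have closed : ∀ x ∈ G, ∀ y ∈ G, x.2 = y.2 → col x = a → col y = b →
      (x.1 ∈ S ↔ y.1 ∈ S) := by
    intro x hx y hy hxy hxa hyb
    constructor
    · intro hxS
      obtain ⟨z, hz, hzb, hzx, hzS⟩ := back x hx hxa hxS
      rwa [← h z hz y hy (Or.inr (hzx.trans hxy)) (hzb.trans hyb.symm)]
    · intro hyS
      refine Relation.ReflTransGen.tail hyS ⟨y.2, hy, hyb, ?_, ?_⟩
      · rw [← hxy]; exact hx
      · rw [← hxy]; exact hxa
  have hv : ∀ x ∈ G, x.2 = e.2 → x.1 ∈ S → col x ≠ a := by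
    intro x hx hxe hxS hxa
    obtain ⟨z, hz, hzb, hzx, -⟩ := back x hx hxa hxS
    exact hb z hz (hzx.trans hxe) hzb
  have hS := h.swap_colors closed
  have hSc := h.swap_colors (T := Sᶜ) (fun x hx y hy hxy hxa hyb =>
    not_congr (closed x hx y hy hxy hxa hyb))
  have hne : ∀ x ∈ G, x ≠ e := fun x hx hxe => he (hxe ▸ hx)
  -- Swapping on `S` frees `b` at `e.1`, and by `hv` it stays free at `e.2`. Swapping on the
  -- complement keeps `a` free at `e.1`, and by `hv` frees it at `e.2`.
  have pS := hS.update he (c := b) (by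
    intro x hx hxe hc
    unfold swapOn at hc
    split_ifs at hc with hxS
    · rw [Equiv.swap_apply_eq_iff, Equiv.swap_apply_right] at hc
      rcases hxe with hxe | hxe
      · exact ha x hx hxe hc
      · exact hv x hx hxe hxS hc
    · rcases hxe with hxe | hxe
      · exact hxS (hxe ▸ heS)
      · exact hb x hx hxe hc)
  have pSc := hSc.update he (c := a) (by
    intro x hx hxe hc
    unfold swapOn at hc
    split_ifs at hc with hxS
    · rw [Equiv.swap_apply_eq_iff, Equiv.swap_apply_left] at hc
      rcases hxe with hxe | hxe
      · exact hxS (hxe ▸ heS)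
      · exact hb x hx hxe hc
    · rcases hxe with hxe | hxe
      · exact ha x hx hxe hc
      · exact hv x hx hxe (not_not.1 hxS) hc)
  -- Color `a` misses `e.1` and color `b` misses `e.2`, so either class has at most `n - 1` edges.
  have cA : (G.filter (fun x => col x = a)).card < n := by
    have : (G.filter (fun x => col x = a)).card ≤ (Finset.univ.erase e.1).card := by
      refine Finset.card_le_card_of_injOn Prod.fst ?_ ?_
      · intro x hx
        rw [Finset.mem_coe, Finset.mem_filter] at hx
        simpa using fun hxe => ha x hx.1 hxe hx.2
      · intro x hx y hy hxy
        rw [Finset.mem_coe, Finset.mem_filter] at hx hy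
        exact h x hx.1 y hy.1 (Or.inl hxy) (hx.2.trans hy.2.symm)
    rw [Finset.card_erase_of_mem (Finset.mem_univ _), Finset.card_univ, Fintype.card_fin] at this
    have := e.1.pos
    omega
  have cB : (G.filter (fun x => col x = b)).card < n := by
    have : (G.filter (fun x => col x = b)).card ≤ (Finset.univ.erase e.2).card := by
      refine Finset.card_le_card_of_injOn Prod.snd ?_ ?_
      · intro x hx
        rw [Finset.mem_coe, Finset.mem_filter] at hx
        simpa using fun hxe => hb x hx.1 hxe hx.2
      · intro x hx y hy hxy
        rw [Finset.mem_coe, Finset.mem_filter] at hx hy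
        exact h x hx.1 y hy.1 (Or.inr hxy) (hx.2.trans hy.2.symm)
    rw [Finset.card_erase_of_mem (Finset.mem_univ _), Finset.card_univ, Fintype.card_fin] at this
    have := e.2.pos
    omega
  have changed : ∀ (T : Set (Fin n)) (c : Fin k), ∀ x ∈ G,
      Function.update (swapOn col a b T) e c x ≠ col x →
      x.1 ∈ T ∧ (col x = a ∨ col x = b) := by
    intro T c x hx hxc
    rw [Function.update_of_ne (hne x hx)] at hxc
    unfold swapOn at hxc
    split_ifs at hxc with hxT
    · refine ⟨hxT, ?_⟩
      by_contra hab
      rw [not_or] at hab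
      exact hxc (Equiv.swap_apply_of_ne_of_ne hab.1 hab.2)
    · exact absurd rfl hxc
  -- The two exchanges alter disjoint sets of edges of colors `a` and `b`, at most `2 * (n - 1)` in
  -- all, so one of them alters fewer than `n`.
  have total : (G.filter (fun x => Function.update (swapOn col a b S) e b x ≠ col x)).card +
      (G.filter (fun x => Function.update (swapOn col a b Sᶜ) e a x ≠ col x)).card ≤
      (G.filter (fun x => col x = a)).card + (G.filter (fun x => col x = b)).card := by
    rw [← Finset.card_union_of_disjoint]
    · refine (Finset.card_le_card ?_).trans (Finset.card_union_le _ _)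
      intro x hx
      simp only [Finset.mem_union, Finset.mem_filter] at hx ⊢
      rcases hx with ⟨hx, hxc⟩ | ⟨hx, hxc⟩
      · exact (changed _ _ x hx hxc).2.imp (⟨hx, ·⟩) (⟨hx, ·⟩)
      · exact (changed _ _ x hx hxc).2.imp (⟨hx, ·⟩) (⟨hx, ·⟩)
    · rw [Finset.disjoint_left]
      intro x hx hx'
      simp only [Finset.mem_filter] at hx hx'
      exact (changed _ _ x hx'.1 hx'.2).1 (changed _ _ x hx.1 hx.2).1
  by_cases hlt : (G.filter (fun x => Function.update (swapOn col a b S) e b x ≠ col x)).card < n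
  · exact ⟨_, pS, hlt⟩
  · exact ⟨_, pSc, by omega⟩

/-! ### Caches as properly colored graphs -/

/-- The set of the edges of a cache. -/
def Cache.support (M : Cache n k) : Finset (Edge n) :=
  Finset.univ.biUnion M.edges

theorem Cache.mem_support {M : Cache n k} {e : Edge n} : e ∈ M.support ↔ M.Holds e := by
  simp [Cache.support, Cache.Holds]

/-- Each matching contains at most one of a family of pairwise adjacent edges. -/
theorem Cache.card_support_inter_le (M : Cache n k) (A : Finset (Edge n))
    (hA : ∀ x ∈ A, ∀ y ∈ A, x.1 = y.1 ∨ x.2 = y.2) : (M.support ∩ A).card ≤ k := by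
  rw [Cache.support, Finset.biUnion_inter]
  refine Finset.card_biUnion_le.trans ?_
  calc ∑ c, (M.edges c ∩ A).card ≤ ∑ _c : Fin k, 1 := by
        refine Finset.sum_le_sum fun c _ => Finset.card_le_one.2 fun x hx y hy => ?_
        rw [Finset.mem_inter] at hx hy
        exact M.isMatching c x hx.1 y hy.1 (hA x hx.2 y hy.2)
    _ = k := by simp

theorem Cache.card_support_sdiff_le (M M' : Cache n k) :
    (M'.support \ M.support).card ≤ M.fetchCost M' := by
  refine le_trans (Finset.card_le_card ?_) (Finset.card_biUnion_le (s := Finset.univ)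
    (t := fun c => M'.edges c \ M.edges c))
  intro x hx
  simp only [Cache.support, Finset.mem_sdiff, Finset.mem_biUnion, Finset.mem_univ, true_and] at *
  obtain ⟨⟨c, hc⟩, hx⟩ := hx
  exact ⟨c, hc, fun h => hx ⟨c, h⟩⟩

@[simp]
theorem Cache.support_empty : (Cache.empty n k).support = ∅ := by
  ext x
  simp [Cache.support, Cache.empty]

open Classical in
/-- The cache that stores the properly colored set `G` of edges. -/
noncomputable def Cache.ofColoring (G : Finset (Edge n)) (col : Edge n → Fin k) : Cache n k :=
  if h : IsProper G col then
    { edges := fun c => G.filter (fun x => col x = c)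
      isMatching := fun c x hx y hy hxy => by
        rw [Finset.mem_filter] at hx hy
        exact h x hx.1 y hy.1 hxy (hx.2.trans hy.2.symm) }
  else Cache.empty n k

theorem Cache.ofColoring_edges {G : Finset (Edge n)} {col : Edge n → Fin k}
    (h : IsProper G col) (c : Fin k) :
    (Cache.ofColoring G col).edges c = G.filter (fun x => col x = c) := by
  rw [Cache.ofColoring, dif_pos h]

theorem Cache.fetchCost_ofColoring_le {G G' : Finset (Edge n)} {col col' : Edge n → Fin k}
    (h : IsProper G col) (h' : IsProper G' col') :
    (Cache.ofColoring G col).fetchCost (Cache.ofColoring G' col') ≤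
      (G'.filter (fun x => x ∉ G ∨ col' x ≠ col x)).card := by
  unfold Cache.fetchCost
  rw [← Finset.card_biUnion]
  · refine Finset.card_le_card fun x hx => ?_
    simp only [Finset.mem_biUnion, Finset.mem_univ, true_and, Finset.mem_sdiff,
      Cache.ofColoring_edges h, Cache.ofColoring_edges h', Finset.mem_filter] at hx ⊢
    obtain ⟨c, ⟨hx, rfl⟩, hxc⟩ := hx
    refine ⟨hx, ?_⟩
    by_contra hcon
    rw [not_or, not_not, not_not] at hcon
    exact hxc ⟨hcon.1, hcon.2.symm⟩
  · intro c _ d _ hcd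
    rw [Function.onFun, Finset.disjoint_left]
    intro x hx hx'
    simp only [Finset.mem_sdiff, Cache.ofColoring_edges h', Finset.mem_filter] at hx hx'
    exact hcd (hx.1.2.symm.trans hx'.1.2)

/-! ### From graph algorithms to online algorithms: cost `n` per fault -/

/-- An online algorithm that only decides which edges are cached, subject to the degree
constraint, and that loads an edge only when it is requested. -/
structure GraphAlgorithm (n k : ℕ) where
  /-- the edges cached when the last request is served -/
  graph : List (Edge n) → Finset (Edge n)
  graph_nil : graph [] = ∅
  mem_graph : ∀ σ e, e ∈ graph (σ ++ [e])
  graph_subset : ∀ σ e, graph (σ ++ [e]) ⊆ insert e (graph σ)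
  card_fst : ∀ σ u, ((graph σ).filter (fun x => x.1 = u)).card ≤ k
  card_snd : ∀ σ v, ((graph σ).filter (fun x => x.2 = v)).card ≤ k

namespace GraphAlgorithm

/-- The number of requests that are not cached when they arrive. -/
def faults (B : GraphAlgorithm n k) (σ : List (Edge n)) : ℕ :=
  ∑ i ∈ Finset.range σ.length, if ∃ e, σ[i]? = some e ∧ e ∉ B.graph (σ.take i) then 1 else 0

theorem faults_nil (B : GraphAlgorithm n k) : B.faults [] = 0 := rfl

theorem faults_concat (B : GraphAlgorithm n k) (σ : List (Edge n)) (e : Edge n) :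
    B.faults (σ ++ [e]) = B.faults σ + if e ∈ B.graph σ then 0 else 1 := by
  unfold faults
  rw [List.length_append, List.length_singleton, Finset.sum_range_succ]
  congr 1
  · refine Finset.sum_congr rfl fun i hi => ?_
    rw [Finset.mem_range] at hi
    rw [List.getElem?_append_left hi, List.take_append_of_le_length hi.le]
  · by_cases h : e ∈ B.graph σ <;> simp [h]

/-- A hit loads nothing, so the old coloring survives. On a fault the graph without `e` has degree
less than `k` at both endpoints of `e`; fewer than `n` recolored edges plus `e` itself make at most
`n`. -/
theorem exists_recolor (B : GraphAlgorithm n k) (σ : List (Edge n)) (e : Edge n)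
    (col : Edge n → Fin k) (h : IsProper (B.graph σ) col) :
    ∃ col' : Edge n → Fin k, IsProper (B.graph (σ ++ [e])) col' ∧
      ((B.graph (σ ++ [e])).filter (fun x => x ∉ B.graph σ ∨ col' x ≠ col x)).card ≤
        n * if e ∈ B.graph σ then 0 else 1 := by
  by_cases he : e ∈ B.graph σ
  · have hsub : B.graph (σ ++ [e]) ⊆ B.graph σ := by
      have := B.graph_subset σ e
      rwa [Finset.insert_eq_of_mem he] at this
    refine ⟨col, h.mono hsub, ?_⟩
    rw [if_pos he, mul_zero, Nat.le_zero, Finset.card_eq_zero, Finset.filter_eq_empty_iff]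
    intro x hx
    simpa using hsub hx
  · have hsub : (B.graph (σ ++ [e])).erase e ⊆ B.graph σ :=
      Finset.subset_insert_iff.1 (B.graph_subset σ e)
    have lt : ∀ p : Edge n → Prop, ∀ [DecidablePred p], p e →
        ((B.graph (σ ++ [e])).filter p).card ≤ k →
        (((B.graph (σ ++ [e])).erase e).filter p).card < k := by
      intro p _ hp hk
      refine lt_of_lt_of_le (Finset.card_lt_card ?_) hk
      rw [Finset.filter_erase]
      exact Finset.erase_ssubset (Finset.mem_filter.2 ⟨B.mem_graph σ e, hp⟩)
    obtain ⟨col', hp, hc⟩ := (h.mono hsub).exists_insert (Finset.notMem_erase e _)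
      (lt _ rfl (B.card_fst _ _)) (lt _ rfl (B.card_snd _ _))
    rw [Finset.insert_erase (B.mem_graph σ e)] at hp
    refine ⟨col', hp, ?_⟩
    rw [if_neg he, mul_one]
    refine le_trans ?_ (Nat.succ_le_of_lt hc)
    refine le_trans (Finset.card_le_card ?_) (Finset.card_insert_le e _)
    intro x hx
    rw [Finset.mem_filter] at hx
    rw [Finset.mem_insert, Finset.mem_filter, Finset.mem_erase]
    by_cases hxe : x = e
    · exact Or.inl hxe
    · have hx' := Finset.mem_erase.2 ⟨hxe, hx.1⟩
      exact Or.inr ⟨⟨hxe, hx.1⟩, hx.2.resolve_left (not_not.2 (hsub hx'))⟩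

open Classical in
/-- The colors of the edges after the request `e`. -/
noncomputable def recolor (B : GraphAlgorithm n k) (σ : List (Edge n)) (e : Edge n)
    (col : Edge n → Fin k) : Edge n → Fin k :=
  if h : IsProper (B.graph σ) col then (B.exists_recolor σ e col h).choose else col

/-- The requests served so far and the colors of the edges. -/
noncomputable def coloringState (B : GraphAlgorithm n k) (c : Fin k) (σ : List (Edge n)) :
    List (Edge n) × (Edge n → Fin k) :=
  -- The prefix is carried along because `recolor` needs the graph before the request. The initial
  -- color is irrelevant, as the initial graph is empty.
  σ.foldl (fun s e => (s.1 ++ [e], B.recolor s.1 e s.2)) ([], fun _ => c)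

theorem coloringState_fst (B : GraphAlgorithm n k) (c : Fin k) (σ : List (Edge n)) :
    (B.coloringState c σ).1 = σ := by
  induction σ using List.reverseRecOn with
  | nil => rfl
  | append_singleton σ e ih =>
    rw [coloringState, List.foldl_concat]
    exact congrArg (· ++ [e]) ih

/-- The colors of the edges after the requests `σ`. -/
noncomputable def coloring (B : GraphAlgorithm n k) (c : Fin k) (σ : List (Edge n)) :
    Edge n → Fin k :=
  (B.coloringState c σ).2

theorem coloring_concat (B : GraphAlgorithm n k) (c : Fin k) (σ : List (Edge n)) (e : Edge n) :
    B.coloring c (σ ++ [e]) = B.recolor σ e (B.coloring c σ) := by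
  have := B.coloringState_fst c σ
  rw [coloring, coloringState, List.foldl_concat]
  change B.recolor (B.coloringState c σ).1 e _ = _
  rw [this]
  rfl

theorem isProper_coloring (B : GraphAlgorithm n k) (c : Fin k) (σ : List (Edge n)) :
    IsProper (B.graph σ) (B.coloring c σ) := by
  induction σ using List.reverseRecOn with
  | nil => simp [IsProper, B.graph_nil]
  | append_singleton σ e ih =>
    rw [coloring_concat, recolor, dif_pos ih]
    exact (B.exists_recolor σ e _ ih).choose_spec.1

/-- The algorithm that stores the edges chosen by `B`, repairing their coloring on the way. -/
noncomputable def toOnline (B : GraphAlgorithm n k) (c : Fin k) : OnlineAlgorithm n k where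
  cache σ := Cache.ofColoring (B.graph σ) (B.coloring c σ)
  cache_nil := by
    ext1
    funext d
    rw [Cache.ofColoring_edges (B.isProper_coloring c []), B.graph_nil]
    rfl
  holds_request σ e := by
    refine ⟨B.coloring c (σ ++ [e]) e, ?_⟩
    rw [Cache.ofColoring_edges (B.isProper_coloring c _)]
    exact Finset.mem_filter.2 ⟨B.mem_graph σ e, rfl⟩

end GraphAlgorithm

theorem OnlineAlgorithm.cost_nil (A : OnlineAlgorithm n k) : A.cost [] = 0 := rfl

theorem OnlineAlgorithm.cost_concat (A : OnlineAlgorithm n k) (σ : List (Edge n)) (e : Edge n) :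
    A.cost (σ ++ [e]) = A.cost σ + (A.cache σ).fetchCost (A.cache (σ ++ [e])) := by
  unfold OnlineAlgorithm.cost scheduleCost
  rw [List.length_append, List.length_singleton, Finset.sum_range_succ]
  congr 1
  · refine Finset.sum_congr rfl fun i hi => ?_
    rw [Finset.mem_range] at hi
    simp only [List.take_append_of_le_length hi.le, List.take_append_of_le_length hi]
  · have : (σ ++ [e]).take (σ.length + 1) = σ ++ [e] := List.take_of_length_le (by simp)
    simp only [List.take_left, this]

theorem GraphAlgorithm.cost_toOnline_le (B : GraphAlgorithm n k) (c : Fin k)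
    (σ : List (Edge n)) : (B.toOnline c).cost σ ≤ n * B.faults σ := by
  induction σ using List.reverseRecOn with
  | nil => simp [OnlineAlgorithm.cost_nil]
  | append_singleton σ e ih =>
    rw [OnlineAlgorithm.cost_concat, B.faults_concat, mul_add]
    refine add_le_add ih ?_
    refine (Cache.fetchCost_ofColoring_le (B.isProper_coloring c _)
      (B.isProper_coloring c _)).trans ?_
    have ih := B.isProper_coloring c σ
    rw [coloring_concat, recolor, dif_pos ih]
    exact (B.exists_recolor σ e _ ih).choose_spec.2

theorem Serves.of_concat {S : ℕ → Cache n k} {σ : List (Edge n)} {e : Edge n}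
    (h : Serves S (σ ++ [e])) : Serves S σ := by
  refine ⟨h.1, fun i hi => ?_⟩
  have := h.2 i (by rw [List.length_append]; omega)
  rwa [List.getElem_append_left hi] at this

theorem Serves.mem_support_concat {S : ℕ → Cache n k} {σ : List (Edge n)} {e : Edge n}
    (h : Serves S (σ ++ [e])) : e ∈ (S (σ.length + 1)).support := by
  have := h.2 σ.length (by simp)
  rw [List.getElem_concat_length rfl] at this
  exact Cache.mem_support.2 this

/-- The optimal offline cost is attained. -/
theorem OnlineAlgorithm.exists_optimal (A : OnlineAlgorithm n k) (σ : List (Edge n)) :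
    ∃ S : ℕ → Cache n k, Serves S σ ∧ scheduleCost S σ.length = optCost k σ := by
  refine Nat.sInf_mem (s := {x | ∃ S : ℕ → Cache n k, Serves S σ ∧
    -- The infimum is attained only over a nonempty set; the run of `A` is a schedule in it.
    scheduleCost S σ.length = x}) ⟨A.cost σ, fun i => A.cache (σ.take i), ⟨A.cache_nil, ?_⟩, rfl⟩
  intro i hi
  have := A.holds_request (σ.take i) σ[i]
  rwa [List.take_append_getElem] at this

end CachingInMatchings

/-! ### The deterministic marking algorithm -/

namespace CachingInMatchings

variable {n k : ℕ}

/-- The edges at a node; the two summands of the index type are the two sides of the graph. -/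
def star : Fin n ⊕ Fin n → Finset (Edge n)
  | Sum.inl u => Finset.univ.filter (fun x => x.1 = u)
  | Sum.inr v => Finset.univ.filter (fun x => x.2 = v)

theorem mem_star_inl {x : Edge n} {u : Fin n} : x ∈ star (Sum.inl u) ↔ x.1 = u := by
  simp [star]

theorem mem_star_inr {x : Edge n} {v : Fin n} : x ∈ star (Sum.inr v) ↔ x.2 = v := by
  simp [star]

theorem inter_star_inl (G : Finset (Edge n)) (u : Fin n) :
    G ∩ star (Sum.inl u) = G.filter (fun x => x.1 = u) := by
  ext x
  rw [Finset.mem_inter, mem_star_inl, Finset.mem_filter]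

theorem inter_star_inr (G : Finset (Edge n)) (v : Fin n) :
    G ∩ star (Sum.inr v) = G.filter (fun x => x.2 = v) := by
  ext x
  rw [Finset.mem_inter, mem_star_inr, Finset.mem_filter]

theorem sum_card_inter_star (G : Finset (Edge n)) :
    ∑ w, (G ∩ star w).card = 2 * G.card := by
  rw [Fintype.sum_sum_type, two_mul]
  congr 1
  · simp_rw [inter_star_inl]
    exact (Finset.card_eq_sum_card_fiberwise fun x _ => Finset.mem_univ x.1).symm
  · simp_rw [inter_star_inr]
    exact (Finset.card_eq_sum_card_fiberwise fun x _ => Finset.mem_univ x.2).symm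

theorem Cache.card_support_inter_star_le (M : Cache n k) (w : Fin n ⊕ Fin n) :
    (M.support ∩ star w).card ≤ k := by
  refine M.card_support_inter_le _ fun x hx y hy => ?_
  rcases w with u | v
  · rw [mem_star_inl] at hx hy
    exact Or.inl (hx.trans hy.symm)
  · rw [mem_star_inr] at hx hy
    exact Or.inr (hx.trans hy.symm)

/-- Evict an edge of the set `A` from the graph `G` with the set `M` of marked edges, if `G`
contains `k` edges of `A`. -/
theorem exists_makeRoom (hk : 1 ≤ k) {G M A : Finset (Edge n)} (hM : M ⊆ G)
    (hA : (G ∩ A).card ≤ k) :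
    ∃ G' M' : Finset (Edge n), M' ⊆ G' ∧ G' ⊆ G ∧ (G' ∩ A).card < k ∧
      ∀ H : Finset (Edge n), ∀ e ∈ H ∩ A, e ∉ G → (H ∩ A).card ≤ k →
        k * (M' ∪ H).card + M.card ≤ k * (M ∪ H).card + M'.card := by
  rcases hA.lt_or_eq with hlt | heq
  · exact ⟨G, M, hM, subset_rfl, hlt, fun _ _ _ _ _ => le_rfl⟩
  have evict : ∀ x ∈ G ∩ A, (G.erase x ∩ A).card < k := by
    intro x hx
    rw [← heq, Finset.erase_inter]
    exact Finset.card_lt_card (Finset.erase_ssubset hx)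
  by_cases hsub : G ∩ A ⊆ M
  · obtain ⟨x, hx⟩ : (G ∩ A).Nonempty := Finset.card_pos.1 (by omega)
    have hMA : M ∩ A = G ∩ A := Finset.Subset.antisymm (Finset.inter_subset_inter_right hM)
      (Finset.subset_inter hsub Finset.inter_subset_right)
    refine ⟨G.erase x, M \ A, ?_, Finset.erase_subset _ _, evict x hx, ?_⟩
    · intro y hy
      rw [Finset.mem_sdiff] at hy
      refine Finset.mem_erase.2 ⟨?_, hM hy.1⟩
      rintro rfl
      exact hy.2 (Finset.mem_inter.1 hx).2
    -- Unmarking lowers `|M|` by `k`, so `|M ∪ H|` must drop. It does: `H` has at most `k` edges in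
    -- `A`, one of them is `e ∉ G`, so some of the `k` marked edges of `G ∩ A` is outside `H`.
    · intro H e he heG hH
      have h1 : ((H ∩ A).erase e).card < (G ∩ A).card := by
        rw [heq]
        exact (Finset.card_lt_card (Finset.erase_ssubset he)).trans_le hH
      obtain ⟨y, hyG, hyH⟩ := Finset.exists_mem_notMem_of_card_lt_card h1
      have hyA := (Finset.mem_inter.1 hyG).2
      have hyH' : y ∉ H := by
        intro hy
        refine hyH (Finset.mem_erase.2 ⟨?_, Finset.mem_inter.2 ⟨hy, hyA⟩⟩)
        rintro rfl
        exact heG (Finset.mem_inter.1 hyG).1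
      have h2 : (M \ A ∪ H).card < (M ∪ H).card := by
        refine Finset.card_lt_card ((Finset.ssubset_iff_of_subset
          (Finset.union_subset_union_left Finset.sdiff_subset)).2
          ⟨y, Finset.mem_union_left _ (hsub hyG), ?_⟩)
        rw [Finset.mem_union, Finset.mem_sdiff]
        tauto
      have h3 := Finset.card_sdiff_add_card_inter M A
      rw [hMA, heq] at h3
      have h4 := Nat.mul_le_mul_left k (Nat.succ_le_of_lt h2)
      rw [Nat.mul_succ] at h4
      omega
  · obtain ⟨x, hx, hxM⟩ := Finset.not_subset.1 hsub
    exact ⟨G.erase x, M, Finset.subset_erase.2 ⟨hM, hxM⟩, Finset.erase_subset _ _, evict x hx,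
      fun _ _ _ _ _ => le_rfl⟩

/-- A graph of maximal degree at most `k` with a set of marked edges. -/
def IsMarkedGraph (k : ℕ) (s : Finset (Edge n) × Finset (Edge n)) : Prop :=
  s.2 ⊆ s.1 ∧ ∀ w, (s.1 ∩ star w).card ≤ k

/-- Making room at either endpoint does not raise `k * |M ∪ H| - |M|`. Marking `e` then lowers it by
one, since `e ∈ H` leaves the union unchanged, and this pays for the fault. -/
theorem exists_markingStep (hk : 1 ≤ k) {s : Finset (Edge n) × Finset (Edge n)}
    (hs : IsMarkedGraph k s) (e : Edge n) :
    ∃ t : Finset (Edge n) × Finset (Edge n), IsMarkedGraph k t ∧ e ∈ t.1 ∧ t.1 ⊆ insert e s.1 ∧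
      ∀ H : Finset (Edge n), e ∈ H → (∀ w, (H ∩ star w).card ≤ k) →
        (if e ∈ s.1 then 0 else 1) + k * (t.2 ∪ H).card + s.2.card ≤
          k * (s.2 ∪ H).card + t.2.card := by
  by_cases he : e ∈ s.1
  · refine ⟨s, hs, he, Finset.subset_insert _ _, fun H _ _ => ?_⟩
    rw [if_pos he]
    omega
  obtain ⟨G₁, M₁, hM₁, hG₁, hc₁, hp₁⟩ := exists_makeRoom hk hs.1 (hs.2 (Sum.inl e.1))
  obtain ⟨G₂, M₂, hM₂, hG₂, hc₂, hp₂⟩ := exists_makeRoom hk hM₁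
    ((Finset.card_le_card (Finset.inter_subset_inter_right hG₁)).trans (hs.2 (Sum.inr e.2)))
  have he₁ : e ∉ G₁ := fun h => he (hG₁ h)
  have he₂ : e ∉ M₂ := fun h => he₁ (hG₂ (hM₂ h))
  refine ⟨(insert e G₂, insert e M₂), ⟨Finset.insert_subset_insert e hM₂, fun w => ?_⟩,
    Finset.mem_insert_self _ _, Finset.insert_subset_insert e (hG₂.trans hG₁), ?_⟩
  · change (insert e G₂ ∩ star w).card ≤ k
    by_cases hw : e ∈ star w
    · rw [Finset.insert_inter_of_mem hw]
      refine (Finset.card_insert_le _ _).trans (Nat.succ_le_of_lt ?_)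
      rcases w with u | v
      · rw [mem_star_inl] at hw
        subst hw
        exact (Finset.card_le_card (Finset.inter_subset_inter_right hG₂)).trans_lt hc₁
      · rw [mem_star_inr] at hw
        subst hw
        exact hc₂
    · rw [Finset.insert_inter_of_notMem hw]
      exact (Finset.card_le_card (Finset.inter_subset_inter_right (hG₂.trans hG₁))).trans (hs.2 w)
  · intro H heH hH
    have h₁ := hp₁ H e (Finset.mem_inter.2 ⟨heH, mem_star_inl.2 rfl⟩) he (hH _)
    have h₂ := hp₂ H e (Finset.mem_inter.2 ⟨heH, mem_star_inr.2 rfl⟩) he₁ (hH _)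
    have h₃ : insert e M₂ ∪ H = M₂ ∪ H := by
      rw [Finset.insert_union, Finset.insert_eq_of_mem (Finset.mem_union_right _ heH)]
    change _ + k * (insert e M₂ ∪ H).card + _ ≤ _ + (insert e M₂).card
    rw [if_neg he, h₃, Finset.card_insert_of_notMem he₂]
    omega

/-- The marked graph of the deterministic algorithm after the requests `σ`. -/
noncomputable def markingState (hk : 1 ≤ k) (σ : List (Edge n)) :
    {s : Finset (Edge n) × Finset (Edge n) // IsMarkedGraph k s} :=
  σ.foldl (fun s e => ⟨(exists_markingStep hk s.2 e).choose,
    (exists_markingStep hk s.2 e).choose_spec.1⟩) ⟨(∅, ∅), by simp [IsMarkedGraph]⟩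

theorem markingState_concat (hk : 1 ≤ k) (σ : List (Edge n)) (e : Edge n) :
    (markingState hk (σ ++ [e])).1 =
      (exists_markingStep hk (markingState hk σ).2 e).choose := by
  rw [markingState, List.foldl_concat]
  rfl

/-- The deterministic algorithm: when an edge has to be loaded at a node of degree `k`, an
unmarked edge is evicted there, after unmarking all edges at this node if necessary. -/
noncomputable def markingGraph (n : ℕ) (hk : 1 ≤ k) : GraphAlgorithm n k where
  graph σ := (markingState hk σ).1.1
  graph_nil := rfl
  mem_graph σ e := by
    rw [markingState_concat]
    exact (exists_markingStep hk (markingState hk σ).2 e).choose_spec.2.1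
  graph_subset σ e := by
    rw [markingState_concat]
    exact (exists_markingStep hk (markingState hk σ).2 e).choose_spec.2.2.1
  card_fst σ u := by
    rw [← inter_star_inl]
    exact (markingState hk σ).2.2 _
  card_snd σ v := by
    rw [← inter_star_inr]
    exact (markingState hk σ).2.2 _

/-- The offline move enlarges `M ∪ H` by at most one edge per fetch; `exists_markingStep` covers the
online move. -/
theorem faults_markingGraph_add_le (hk : 1 ≤ k) (σ : List (Edge n)) (S : ℕ → Cache n k)
    (hS : Serves S σ) :
    (markingGraph n hk).faults σ + k * ((markingState hk σ).1.2 ∪ (S σ.length).support).card ≤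
      k * scheduleCost S σ.length + (markingState hk σ).1.2.card := by
  induction σ using List.reverseRecOn with
  | nil =>
    rw [GraphAlgorithm.faults_nil, List.length_nil, hS.1, Cache.support_empty]
    simp [markingState]
  | append_singleton σ e ih =>
    have ih := ih hS.of_concat
    have step := (exists_markingStep hk (markingState hk σ).2 e).choose_spec.2.2.2
      (S (σ.length + 1)).support hS.mem_support_concat
      (fun w => Cache.card_support_inter_star_le _ w)
    rw [← markingState_concat] at step
    have h1 : ((markingState hk σ).1.2 ∪ (S (σ.length + 1)).support).card ≤
        ((markingState hk σ).1.2 ∪ (S σ.length).support).card +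
          (S σ.length).fetchCost (S (σ.length + 1)) := by
      refine le_trans (Finset.card_le_card ?_) ((Finset.card_union_le _ _).trans
        (Nat.add_le_add_left (Cache.card_support_sdiff_le (S σ.length) (S (σ.length + 1))) _))
      intro x
      simp only [Finset.mem_union, Finset.mem_sdiff]
      tauto
    have h2 := Nat.mul_le_mul_left k h1
    have h3 : scheduleCost S (σ.length + 1) =
        scheduleCost S σ.length + (S σ.length).fetchCost (S (σ.length + 1)) :=
      Finset.sum_range_succ _ _
    have h4 : (markingGraph n hk).faults (σ ++ [e]) = (markingGraph n hk).faults σ +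
        if e ∈ (markingState hk σ).1.1 then 0 else 1 := GraphAlgorithm.faults_concat _ _ _
    rw [List.length_append, List.length_singleton, h3, h4]
    rw [mul_add] at h2 ⊢
    omega

theorem faults_markingGraph_le (hk : 1 ≤ k) (σ : List (Edge n)) (S : ℕ → Cache n k)
    (hS : Serves S σ) : (markingGraph n hk).faults σ ≤ k * scheduleCost S σ.length := by
  have h1 := faults_markingGraph_add_le hk σ S hS
  have h2 : (markingState hk σ).1.2.card ≤
      k * ((markingState hk σ).1.2 ∪ (S σ.length).support).card :=
    (Finset.card_le_card Finset.subset_union_left).trans (Nat.le_mul_of_pos_left _ hk)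
  omega

theorem exists_deterministic (n : ℕ) (hk : 1 ≤ k) :
    ∃ A : OnlineAlgorithm n k, A.IsCompetitive ((n : ℝ) * (k : ℝ)) := by
  refine ⟨(markingGraph n hk).toOnline ⟨0, hk⟩, 0, fun σ => ?_⟩
  obtain ⟨S, hS, hopt⟩ := ((markingGraph n hk).toOnline ⟨0, hk⟩).exists_optimal σ
  have h := ((markingGraph n hk).cost_toOnline_le ⟨0, hk⟩ σ).trans
    (Nat.mul_le_mul_left n (faults_markingGraph_le hk σ S hS))
  rw [hopt, ← mul_assoc] at h
  rw [add_zero]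
  exact_mod_cast h

end CachingInMatchings

namespace CachingInMatchings

/-! ### Ranks in a random order -/

section Rank

variable {α : Type}

/-- The number of elements of `U` that precede `x` in the order given by `ω`. -/
def rank [Fintype α] (ω : α ≃ Fin (Fintype.card α)) (U : Finset α) (x : α) : ℕ :=
  (U.filter (fun y => ω y < ω x)).card

theorem rank_lt_rank [Fintype α] {ω : α ≃ Fin (Fintype.card α)} {U : Finset α} {x y : α}
    (hx : x ∈ U) (hxy : ω x < ω y) : rank ω U x < rank ω U y := by
  refine Finset.card_lt_card ((Finset.ssubset_iff_of_subset fun z hz => ?_).2 ⟨x, ?_, ?_⟩)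
  · rw [Finset.mem_filter] at hz ⊢
    exact ⟨hz.1, hz.2.trans hxy⟩
  · exact Finset.mem_filter.2 ⟨hx, hxy⟩
  · simp

theorem rank_injOn [Fintype α] (ω : α ≃ Fin (Fintype.card α)) (U : Finset α) :
    Set.InjOn (rank ω U) U := by
  intro x hx y hy hxy
  by_contra hne
  rcases lt_or_gt_of_ne (ω.injective.ne hne) with h | h
  · exact (rank_lt_rank hx h).ne hxy
  · exact (rank_lt_rank hy h).ne' hxy

theorem rank_lt_card [Fintype α] (ω : α ≃ Fin (Fintype.card α)) {U : Finset α} {x : α} (hx : x ∈ U) :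
    rank ω U x < U.card :=
  Finset.card_lt_card (Finset.filter_ssubset.2 ⟨x, hx, lt_irrefl _⟩)

/-- The ranks of the elements of `U` are exactly `0, …, |U| - 1`. -/
theorem card_filter_rank_lt [Fintype α] (ω : α ≃ Fin (Fintype.card α)) (U : Finset α) (c : ℕ) :
    (U.filter (fun x => rank ω U x < c)).card = min U.card c := by
  have himage : U.image (rank ω U) = Finset.range U.card := by
    refine Finset.eq_of_subset_of_card_le (fun i hi => ?_) ?_
    · obtain ⟨x, hx, rfl⟩ := Finset.mem_image.1 hi
      exact Finset.mem_range.2 (rank_lt_card ω hx)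
    · rw [Finset.card_range, Finset.card_image_of_injOn (rank_injOn ω U)]
  have hinj : Set.InjOn (rank ω U) (U.filter (fun x => rank ω U x < c)) :=
    (rank_injOn ω U).mono (Finset.coe_subset.2 (Finset.filter_subset _ _))
  rw [← Finset.card_image_of_injOn hinj, ← Finset.card_range (min U.card c)]
  congr 1
  have h := Finset.filter_image (f := rank ω U) (s := U) (p := fun i => i < c)
  rw [← h, himage]
  ext i
  simp

variable [DecidableEq α]

theorem rank_swap_trans [Fintype α] (ω : α ≃ Fin (Fintype.card α)) {U : Finset α} {p q : α}
    (hp : p ∈ U) (hq : q ∈ U) : rank ((Equiv.swap p q).trans ω) U p = rank ω U q := by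
  have hU : ∀ x ∈ U, Equiv.swap p q x ∈ U := by
    intro x hx
    rcases Equiv.swap_apply_def p q x with h
    rw [h]
    split_ifs <;> assumption
  unfold rank
  refine Finset.card_bij' (fun x _ => Equiv.swap p q x) (fun x _ => Equiv.swap p q x) ?_ ?_ ?_ ?_
  · intro x hx
    rw [Finset.mem_filter] at hx ⊢
    exact ⟨hU x hx.1, by simpa using hx.2⟩
  · intro x hx
    rw [Finset.mem_filter] at hx ⊢
    exact ⟨hU x hx.1, by simpa using hx.2⟩
  · simp
  · simp

/-- In a random order, an element of `U` is among the first `c` elements of `U` with probability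
at most `c / |U|`. -/
theorem card_mul_card_rank_lt_le [Fintype α] {U : Finset α} {p : α} (hp : p ∈ U) (c : ℕ) :
    U.card * (Finset.univ.filter
      (fun ω : α ≃ Fin (Fintype.card α) => rank ω U p < c)).card ≤
      Fintype.card (α ≃ Fin (Fintype.card α)) * c := by
  have hsymm : ∀ q ∈ U,
      (Finset.univ.filter (fun ω : α ≃ Fin (Fintype.card α) => rank ω U q < c)).card =
      (Finset.univ.filter (fun ω : α ≃ Fin (Fintype.card α) => rank ω U p < c)).card := by
    intro q hq
    refine Finset.card_bij' (fun ω _ => (Equiv.swap p q).trans ω)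
      (fun ω _ => (Equiv.swap p q).trans ω) ?_ ?_ ?_ ?_
    · intro ω hω
      rw [Finset.mem_filter] at hω ⊢
      exact ⟨Finset.mem_univ _, by rw [rank_swap_trans ω hp hq]; exact hω.2⟩
    · intro ω hω
      rw [Finset.mem_filter] at hω ⊢
      exact ⟨Finset.mem_univ _, by
        rw [Equiv.swap_comm, rank_swap_trans ω hq hp]; exact hω.2⟩
    · intro ω _
      ext x
      simp
    · intro ω _
      ext x
      simp
  -- By symmetry the left side counts all pairs of an order and an element of rank below `c`; each
  -- order has at most `c` of these.
  rw [← smul_eq_mul, ← Finset.sum_const, ← Finset.sum_congr rfl hsymm]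
  simp_rw [Finset.card_filter]
  rw [Finset.sum_comm]
  simp_rw [← Finset.card_filter]
  refine (Finset.sum_le_card_nsmul _ _ c fun ω _ => ?_).trans_eq ?_
  · rw [card_filter_rank_lt]
    exact min_le_right _ _
  · rw [Finset.card_univ, smul_eq_mul]

/-! ### Randomized marking for paging -/

/-- The pages cached by the randomized marking algorithm for paging. The state `s` consists of the
set of pages requested in the previous phase and of the set of pages requested in the present
phase; pages of the first set are evicted in the order given by `ω`. -/
def virtualCache [Fintype α] (ω : α ≃ Fin (Fintype.card α)) (s : Finset α × Finset α) : Finset α :=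
  s.2 ∪ (s.1 \ s.2).filter (fun x => (s.2 \ s.1).card ≤ rank ω (s.1 \ s.2) x)

/-- The change of the state upon a request of `e`, where only the pages of `A` matter. -/
def pagingStep (k : ℕ) (A : Finset α) (s : Finset α × Finset α) (e : α) :
    Finset α × Finset α :=
  if e ∉ A ∨ e ∈ s.2 then s
  else if s.2.card < k then (s.1, insert e s.2) else (s.2, {e})

theorem card_virtualCache_le [Fintype α] {k : ℕ} (ω : α ≃ Fin (Fintype.card α))
    {s : Finset α × Finset α} (h1 : s.1.card ≤ k) (h2 : s.2.card ≤ k) : (virtualCache ω s).card ≤ k := by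
  refine (Finset.card_union_le _ _).trans ?_
  have h3 := Finset.card_filter_add_card_filter_not (s := s.1 \ s.2)
    (fun x => (s.2 \ s.1).card ≤ rank ω (s.1 \ s.2) x)
  simp_rw [not_le] at h3
  rw [card_filter_rank_lt] at h3
  have h4 := Finset.card_sdiff_add_card_inter s.1 s.2
  have h5 := Finset.card_sdiff_add_card_inter s.2 s.1
  rw [Finset.inter_comm] at h5
  rcases min_cases (s.1 \ s.2).card (s.2 \ s.1).card with h | h <;> omega

/-- Within a phase the eviction threshold only grows and the ranks only fall, so no old page returns
unrequested. A new phase starts from pages of `s.2`, all of which are cached. -/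
theorem virtualCache_pagingStep_subset [Fintype α] (k : ℕ) (A : Finset α)
    (ω : α ≃ Fin (Fintype.card α)) (s : Finset α × Finset α) (e : α) :
    virtualCache ω (pagingStep k A s e) ⊆ insert e (virtualCache ω s) := by
  unfold pagingStep
  split_ifs with h1 h2
  · exact Finset.subset_insert _ _
  · intro x hx
    simp only [virtualCache, Finset.mem_insert, Finset.mem_union, Finset.mem_filter] at hx ⊢
    rcases hx with (hx | hx) | ⟨hx, hr⟩
    · exact Or.inl hx
    · exact Or.inr (Or.inl hx)
    · have hsub : s.1 \ insert e s.2 ⊆ s.1 \ s.2 :=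
        Finset.sdiff_subset_sdiff subset_rfl (Finset.subset_insert _ _)
      refine Or.inr (Or.inr ⟨hsub hx, ?_⟩)
      calc (s.2 \ s.1).card ≤ (insert e s.2 \ s.1).card :=
            Finset.card_le_card (Finset.sdiff_subset_sdiff (Finset.subset_insert _ _) subset_rfl)
        _ ≤ _ := hr
        _ ≤ _ := Finset.card_le_card (Finset.filter_subset_filter _ hsub)
  · intro x hx
    simp only [virtualCache, Finset.mem_insert, Finset.mem_union, Finset.mem_filter,
      Finset.mem_singleton, Finset.mem_sdiff] at hx ⊢
    tauto

theorem mem_pagingStep (k : ℕ) {A : Finset α} (s : Finset α × Finset α) {e : α} (he : e ∈ A) :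
    e ∈ (pagingStep k A s e).2 := by
  unfold pagingStep
  split_ifs with h1 h2
  · exact h1.resolve_left (not_not.2 he)
  · exact Finset.mem_insert_self _ _
  · exact Finset.mem_singleton_self _

theorem card_pagingStep_le {k : ℕ} (hk : 1 ≤ k) (A : Finset α) {s : Finset α × Finset α} (e : α)
    (h : s.1.card ≤ k ∧ s.2.card ≤ k) :
    (pagingStep k A s e).1.card ≤ k ∧ (pagingStep k A s e).2.card ≤ k := by
  unfold pagingStep
  split_ifs with h1 h2
  · exact h
  · exact ⟨h.1, (Finset.card_insert_le _ _).trans h2⟩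
  · exact ⟨h.2, by simpa using hk⟩

/-- The potential of the randomized marking algorithm. -/
noncomputable def markingPotential (s : Finset α × Finset α) : ℝ :=
  (s.2 \ s.1).card * (harmonic (s.1 \ s.2).card : ℝ)

/-- The potential of an offline cache `H` relative to the state of the marking algorithm. -/
def offlinePotential (s : Finset α × Finset α) (H : Finset α) : ℕ :=
  (H \ (s.1 ∪ s.2)).card + (H ∪ s.2).card

/-- The request of `e` starts a new phase, or `e` was not requested in the previous and in the
present phase. -/
def IsNew (k : ℕ) (s : Finset α × Finset α) (e : α) : Prop :=
  e ∉ s.2 ∧ (e ∉ s.1 ∨ k ≤ s.2.card)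

instance (k : ℕ) (s : Finset α × Finset α) (e : α) : Decidable (IsNew k s e) :=
  inferInstanceAs (Decidable (_ ∧ _))

theorem offlinePotential_le (s : Finset α × Finset α) (H H' : Finset α) :
    offlinePotential s H' ≤ offlinePotential s H + 2 * (H' \ H).card := by
  have h1 : (H' \ (s.1 ∪ s.2)).card ≤ (H \ (s.1 ∪ s.2)).card + (H' \ H).card := by
    refine le_trans (Finset.card_le_card fun x => ?_) (Finset.card_union_le _ _)
    simp only [Finset.mem_union, Finset.mem_sdiff]
    tauto
  have h2 : (H' ∪ s.2).card ≤ (H ∪ s.2).card + (H' \ H).card := by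
    refine le_trans (Finset.card_le_card fun x => ?_) (Finset.card_union_le _ _)
    simp only [Finset.mem_union, Finset.mem_sdiff]
    tauto
  unfold offlinePotential
  omega

/-- A new page within a phase leaves `H \ (s.1 ∪ s.2)`. At a phase change `|s.2| ≥ k ≥ |H|`, so `|H
∪ s.2| ≥ |H \ s.2| + |H|`, and `e` leaves `H \ s.2`. -/
theorem offlinePotential_pagingStep_add_le {k : ℕ} {A : Finset α} {s : Finset α × Finset α}
    {H : Finset α} {e : α} (he : e ∈ A) (heH : e ∈ H) (hH : H.card ≤ k) :
    (if IsNew k s e then 1 else 0) + offlinePotential (pagingStep k A s e) H ≤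
      offlinePotential s H := by
  by_cases h2 : e ∈ s.2
  · simp [pagingStep, IsNew, h2]
  have hstep : pagingStep k A s e = if s.2.card < k then (s.1, insert e s.2) else (s.2, {e}) :=
    if_neg (by simp [he, h2])
  rw [hstep]
  unfold offlinePotential
  split_ifs with hn hk hk
  · have h1 : e ∉ s.1 := hn.2.resolve_right (by omega)
    have h3 : (H \ (s.1 ∪ insert e s.2)).card < (H \ (s.1 ∪ s.2)).card := by
      refine Finset.card_lt_card ((Finset.ssubset_iff_of_subset fun x => ?_).2 ⟨e, ?_, ?_⟩)
      · simp only [Finset.mem_union, Finset.mem_sdiff, Finset.mem_insert]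
        tauto
      · simp [heH, h1, h2]
      · simp
    have h4 : H ∪ insert e s.2 = H ∪ s.2 := by
      rw [Finset.union_insert, Finset.insert_eq_of_mem (Finset.mem_union_left _ heH)]
    simp only [h4]
    omega
  · have h3 : (H \ (s.2 ∪ {e})).card < (H \ s.2).card := by
      refine Finset.card_lt_card ((Finset.ssubset_iff_of_subset fun x => ?_).2 ⟨e, ?_, ?_⟩)
      · simp only [Finset.mem_union, Finset.mem_sdiff, Finset.mem_singleton]
        tauto
      · simp [heH, h2]
      · simp
    have h4 : H ∪ {e} = H := Finset.union_eq_left.2 (Finset.singleton_subset_iff.2 heH)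
    have h5 := Finset.card_sdiff_add_card H s.2
    simp only [h4]
    omega
  · rw [zero_add]
    refine add_le_add (Finset.card_le_card fun x => ?_) (Finset.card_le_card fun x => ?_)
    · simp only [Finset.mem_union, Finset.mem_sdiff, Finset.mem_insert]
      tauto
    · simp only [Finset.mem_union, Finset.mem_insert]
      rintro (h | rfl | h) <;> tauto
  · exact absurd ⟨h2, Or.inr (not_lt.1 hk)⟩ hn

theorem harmonic_mono {a b : ℕ} (h : a ≤ b) : (harmonic a : ℝ) ≤ harmonic b := by
  unfold harmonic
  exact_mod_cast Finset.sum_le_sum_of_subset_of_nonneg (Finset.range_mono h)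
    fun i _ _ => by positivity

theorem harmonic_cast_nonneg (a : ℕ) : (0 : ℝ) ≤ harmonic a := by
  simpa using harmonic_mono (Nat.zero_le a)

theorem markingPotential_nonneg (s : Finset α × Finset α) : 0 ≤ markingPotential s :=
  mul_nonneg (Nat.cast_nonneg _) (harmonic_cast_nonneg _)

/-- The number of orders for which a request of `e` in state `s` is a fault. -/
def missCount [Fintype α] (s : Finset α × Finset α) (e : α) : ℕ :=
  (Finset.univ.filter (fun ω : α ≃ Fin (Fintype.card α) => e ∉ virtualCache ω s)).card

/-- An old page is missed with probability at most `|s.2 \ s.1| / |s.1 \ s.2|`, which is exactly the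
drop of the potential. A new request costs at most one miss and raises the potential by at most
`harmonic k`. -/
theorem missCount_add_le [Fintype α] {k : ℕ} {A : Finset α} {s : Finset α × Finset α} {e : α}
    (he : e ∈ A) (h1 : s.1.card ≤ k) (h2 : s.2.card ≤ k) :
    (missCount s e : ℝ) + Fintype.card (α ≃ Fin (Fintype.card α)) *
        markingPotential (pagingStep k A s e) ≤
      Fintype.card (α ≃ Fin (Fintype.card α)) * (markingPotential s +
        (1 + harmonic k) * (if IsNew k s e then 1 else 0 : ℕ)) := by
  set N := Fintype.card (α ≃ Fin (Fintype.card α)) with hN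
  have hmiss : (missCount s e : ℝ) ≤ N := by
    exact_mod_cast (Finset.card_filter_le _ _).trans_eq (Finset.card_univ)
  unfold pagingStep
  by_cases hm : e ∈ s.2
  · have : missCount s e = 0 := by
      rw [missCount, Finset.card_eq_zero, Finset.filter_eq_empty_iff]
      intro ω _
      simp [virtualCache, hm]
    simp [IsNew, hm, this]
  rw [if_neg (by simp [he, hm])]
  split_ifs with hk hn hn
  · -- a new page within a phase
    have hs : e ∉ s.1 := hn.2.resolve_right (by omega)
    have hc : (insert e s.2 \ s.1).card = (s.2 \ s.1).card + 1 := by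
      rw [Finset.insert_sdiff_of_notMem _ hs, Finset.card_insert_of_notMem (by simp [hm])]
    have hu : s.1 \ insert e s.2 = s.1 \ s.2 := by
      ext x
      simp only [Finset.mem_sdiff, Finset.mem_insert]
      refine ⟨fun h => ⟨h.1, fun h' => h.2 (Or.inr h')⟩, fun h => ⟨h.1, ?_⟩⟩
      rintro (rfl | h')
      · exact hs h.1
      · exact h.2 h'
    have hpot : markingPotential (s.1, insert e s.2) =
        markingPotential s + harmonic (s.1 \ s.2).card := by
      simp only [markingPotential, hc, hu]
      push_cast
      ring
    have hH : (harmonic (s.1 \ s.2).card : ℝ) ≤ harmonic k :=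
      harmonic_mono ((Finset.card_le_card Finset.sdiff_subset).trans h1)
    have := mul_le_mul_of_nonneg_left hH (Nat.cast_nonneg (α := ℝ) N)
    rw [hpot]
    push_cast
    nlinarith
  · -- a page of the previous phase
    have hs : e ∈ s.1 := by
      by_contra hs
      exact hn ⟨hm, Or.inl hs⟩
    have hU : e ∈ s.1 \ s.2 := Finset.mem_sdiff.2 ⟨hs, hm⟩
    have hc : insert e s.2 \ s.1 = s.2 \ s.1 := Finset.insert_sdiff_of_mem _ hs
    have hu : (s.1 \ insert e s.2).card + 1 = (s.1 \ s.2).card := by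
      rw [← Finset.card_erase_add_one hU]
      congr 2
      ext x
      simp only [Finset.mem_sdiff, Finset.mem_insert, Finset.mem_erase]
      tauto
    have hpot : markingPotential s = markingPotential (s.1, insert e s.2) +
        (s.2 \ s.1).card / (s.1 \ s.2).card := by
      simp only [markingPotential, hc, ← hu, harmonic_succ]
      push_cast
      ring
    have hle : (missCount s e : ℝ) ≤ N * ((s.2 \ s.1).card / (s.1 \ s.2).card) := by
      have hpos : (0 : ℝ) < (s.1 \ s.2).card := by
        exact_mod_cast Finset.card_pos.2 ⟨e, hU⟩
      rw [← mul_div_assoc, le_div_iff₀ hpos, mul_comm]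
      have : missCount s e = (Finset.univ.filter
          (fun ω : α ≃ Fin (Fintype.card α) =>
            rank ω (s.1 \ s.2) e < (s.2 \ s.1).card)).card := by
        unfold missCount
        congr 1
        refine Finset.filter_congr fun ω _ => ?_
        simp [virtualCache, hm, hs]
      rw [this]
      exact_mod_cast card_mul_card_rank_lt_le hU _
    rw [hpot]
    push_cast
    linarith
  · -- a new phase
    have hpot : markingPotential (s.2, {e}) ≤ harmonic k := by
      have hc : (({e} : Finset α) \ s.2).card = 1 := by
        rw [Finset.sdiff_eq_self_of_disjoint (by simpa using hm), Finset.card_singleton]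
      simp only [markingPotential, hc, Nat.cast_one, one_mul]
      exact harmonic_mono ((Finset.card_le_card Finset.sdiff_subset).trans h2)
    have h3 := mul_le_mul_of_nonneg_left hpot (Nat.cast_nonneg (α := ℝ) N)
    have h4 := mul_nonneg (Nat.cast_nonneg (α := ℝ) N) (markingPotential_nonneg s)
    push_cast
    linarith
  · exact absurd ⟨hm, Or.inr (not_lt.1 hk)⟩ hn

end Rank

end CachingInMatchings

/-! ### The randomized algorithm on the graph -/

namespace CachingInMatchings

variable {n k : ℕ}

/-- The state of the marking algorithm for the edges of `A` after the requests `σ`. -/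
def pagingState (k : ℕ) (A : Finset (Edge n)) (σ : List (Edge n)) :
    Finset (Edge n) × Finset (Edge n) :=
  σ.foldl (pagingStep k A) (∅, ∅)

theorem pagingState_concat (k : ℕ) (A : Finset (Edge n)) (σ : List (Edge n)) (e : Edge n) :
    pagingState k A (σ ++ [e]) = pagingStep k A (pagingState k A σ) e :=
  List.foldl_concat ..

theorem card_pagingState_le (hk : 1 ≤ k) (A : Finset (Edge n)) (σ : List (Edge n)) :
    (pagingState k A σ).1.card ≤ k ∧ (pagingState k A σ).2.card ≤ k := by
  induction σ using List.reverseRecOn with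
  | nil => simp [pagingState]
  | append_singleton σ e ih =>
    rw [pagingState_concat]
    exact card_pagingStep_le hk A e ih

/-- The orders in which edges can be evicted. -/
abbrev Order (n : ℕ) : Type := Edge n ≃ Fin (Fintype.card (Edge n))

instance : Nonempty (Order n) := ⟨Fintype.equivFin _⟩

/-- The edges that are cached by the marking algorithms at both of their endpoints. -/
def randomGraph (k : ℕ) (ω : Order n) (σ : List (Edge n)) : Finset (Edge n) :=
  Finset.univ.filter (fun e => ∀ w, e ∈ star w → e ∈ virtualCache ω (pagingState k (star w) σ))

theorem mem_randomGraph {ω : Order n} {σ : List (Edge n)} {e : Edge n} :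
    e ∈ randomGraph k ω σ ↔ ∀ w, e ∈ star w → e ∈ virtualCache ω (pagingState k (star w) σ) := by
  simp [randomGraph]

theorem card_randomGraph_inter_star_le (hk : 1 ≤ k) (ω : Order n) (σ : List (Edge n))
    (w : Fin n ⊕ Fin n) : (randomGraph k ω σ ∩ star w).card ≤ k := by
  have h := card_pagingState_le hk (star w) σ
  refine (Finset.card_le_card fun x hx => ?_).trans (card_virtualCache_le ω h.1 h.2)
  rw [Finset.mem_inter] at hx
  exact mem_randomGraph.1 hx.1 w hx.2

/-- The algorithm that runs a marking algorithm for paging at every node, where edges are evicted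
in the order `ω`. -/
def randomGraphAlgorithm (hk : 1 ≤ k) (ω : Order n) : GraphAlgorithm n k where
  graph := randomGraph k ω
  graph_nil := by
    ext x
    rw [mem_randomGraph]
    refine iff_of_false (fun h => ?_) (Finset.notMem_empty x)
    have := h (Sum.inl x.1) (mem_star_inl.2 rfl)
    simp [pagingState, virtualCache] at this
  mem_graph σ e := by
    rw [mem_randomGraph]
    intro w hw
    rw [pagingState_concat]
    exact Finset.mem_union_left _ (mem_pagingStep k _ hw)
  graph_subset σ e := by
    intro x hx
    rw [Finset.mem_insert, or_iff_not_imp_left, mem_randomGraph]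
    rw [mem_randomGraph] at hx
    intro hxe w hw
    have := hx w hw
    rw [pagingState_concat] at this
    exact (Finset.mem_insert.1 (virtualCache_pagingStep_subset k _ ω _ e this)).resolve_left hxe
  card_fst σ u := by
    rw [← inter_star_inl]
    exact card_randomGraph_inter_star_le hk ω σ _
  card_snd σ v := by
    rw [← inter_star_inr]
    exact card_randomGraph_inter_star_le hk ω σ _

/-- The algorithm that chooses an eviction order uniformly at random. -/
noncomputable def randomMarking (n : ℕ) (hk : 1 ≤ k) : RandomizedAlgorithm n k where
  Ω := Order n
  measurableSpace := ⊤
  μ := letI : MeasurableSpace (Order n) := ⊤; (PMF.uniformOfFintype (Order n)).toMeasure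
  isProbabilityMeasure :=
    letI : MeasurableSpace (Order n) := ⊤; PMF.toMeasure.isProbabilityMeasure _
  alg ω := (randomGraphAlgorithm hk ω).toOnline ⟨0, hk⟩
  measurableSet_cache_eq _ _ := MeasurableSpace.measurableSet_top

theorem card_mul_expectedCost (hk : 1 ≤ k) (σ : List (Edge n)) :
    Fintype.card (Order n) * (randomMarking n hk).expectedCost σ =
      ∑ ω : Order n, (((randomGraphAlgorithm hk ω).toOnline ⟨0, hk⟩).cost σ : ℝ) := by
  let : MeasurableSpace (Order n) := ⊤
  have hN : (Fintype.card (Order n) : ℝ) ≠ 0 := by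
    exact_mod_cast Fintype.card_ne_zero
  have h : (randomMarking n hk).expectedCost σ =
      ∫ ω, (((randomGraphAlgorithm hk ω).toOnline ⟨0, hk⟩).cost σ : ℝ)
        ∂(PMF.uniformOfFintype (Order n)).toMeasure := rfl
  rw [h, PMF.integral_eq_sum, Finset.mul_sum]
  refine Finset.sum_congr rfl fun ω _ => ?_
  rw [PMF.uniformOfFintype_apply, ENNReal.toReal_inv, ENNReal.toReal_natCast, smul_eq_mul,
    mul_inv_cancel_left₀ hN]

/-- A request that is not cached is a fault at one of its endpoints. -/
theorem sum_notMem_randomGraph_le (k : ℕ) (σ : List (Edge n)) (e : Edge n) :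
    ∑ ω : Order n, (if e ∈ randomGraph k ω σ then 0 else 1) ≤
      ∑ w, if e ∈ star w then missCount (pagingState k (star w) σ) e else 0 := by
  have h : ∀ w : Fin n ⊕ Fin n,
      (if e ∈ star w then missCount (pagingState k (star w) σ) e else 0) =
      ∑ ω : Order n,
        if e ∈ star w ∧ e ∉ virtualCache ω (pagingState k (star w) σ) then 1 else 0 := by
    intro w
    rw [← Finset.card_filter]
    split_ifs with hw <;> simp [hw, missCount]
  rw [Finset.sum_congr rfl fun w _ => h w, Finset.sum_comm]
  refine Finset.sum_le_sum fun ω _ => ?_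
  split_ifs with he
  · exact Nat.zero_le _
  · rw [mem_randomGraph] at he
    push Not at he
    obtain ⟨w, hw, hw'⟩ := he
    refine le_trans ?_ (Finset.single_le_sum (fun _ _ => Nat.zero_le _) (Finset.mem_univ w))
    rw [if_pos ⟨hw, hw'⟩]

theorem node_potential_le (hk : 1 ≤ k) (σ : List (Edge n)) {e : Edge n} (w : Fin n ⊕ Fin n)
    (M : Cache n k) {M' : Cache n k} (he : e ∈ M'.support) :
    ((if e ∈ star w then missCount (pagingState k (star w) σ) e else 0 : ℕ) : ℝ) +
      Fintype.card (Order n) * (markingPotential (pagingState k (star w) (σ ++ [e])) +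
        (1 + harmonic k) *
          offlinePotential (pagingState k (star w) (σ ++ [e])) (M'.support ∩ star w)) ≤
      Fintype.card (Order n) * (markingPotential (pagingState k (star w) σ) +
        (1 + harmonic k) * (offlinePotential (pagingState k (star w) σ) (M.support ∩ star w) +
          2 * ((M'.support \ M.support) ∩ star w).card)) := by
  have hL : (0 : ℝ) ≤ Fintype.card (Order n) * (1 + harmonic k) :=
    mul_nonneg (Nat.cast_nonneg _) (add_nonneg zero_le_one (harmonic_cast_nonneg k))
  have hoff := offlinePotential_le (pagingState k (star w) σ) (M.support ∩ star w)
    (M'.support ∩ star w)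
  have hsdiff : (M'.support ∩ star w) \ (M.support ∩ star w) =
      (M'.support \ M.support) ∩ star w := by
    ext x
    simp only [Finset.mem_sdiff, Finset.mem_inter]
    tauto
  rw [hsdiff] at hoff
  rw [pagingState_concat]
  by_cases hw : e ∈ star w
  · have hs := card_pagingState_le hk (star w) σ
    have hmiss := missCount_add_le hw hs.1 hs.2
    have hnew := offlinePotential_pagingStep_add_le (k := k) (s := pagingState k (star w) σ)
      hw (Finset.mem_inter.2 ⟨he, hw⟩) (M'.card_support_inter_star_le w)
    have h := mul_le_mul_of_nonneg_left (Nat.cast_le (α := ℝ) |>.2 (hnew.trans hoff)) hL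
    rw [if_pos hw]
    push_cast at h hmiss ⊢
    linarith
  · have hstep : pagingStep k (star w) (pagingState k (star w) σ) e = pagingState k (star w) σ :=
      if_pos (Or.inl hw)
    have h := mul_le_mul_of_nonneg_left (Nat.cast_le (α := ℝ) |>.2 hoff) hL
    rw [if_neg hw, hstep]
    push_cast at h ⊢
    linarith

/-- Sum of `node_potential_le` over all nodes. The 4 is 2 for the two terms of `offlinePotential`
times 2 for the two endpoints of a fetched edge. -/
theorem sum_faults_add_le (hk : 1 ≤ k) (σ : List (Edge n)) (S : ℕ → Cache n k)
    (hS : Serves S σ) :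
    (∑ ω : Order n, (randomGraphAlgorithm hk ω).faults σ : ℕ) +
      Fintype.card (Order n) * ∑ w, (markingPotential (pagingState k (star w) σ) +
        (1 + harmonic k) *
          offlinePotential (pagingState k (star w) σ) ((S σ.length).support ∩ star w)) ≤
      Fintype.card (Order n) * ((1 + harmonic k) * (4 * scheduleCost S σ.length) : ℝ) := by
  induction σ using List.reverseRecOn with
  | nil =>
    simp [hS.1, GraphAlgorithm.faults_nil, pagingState, markingPotential, offlinePotential,
      scheduleCost]
  | append_singleton σ e ih =>
    have ih := ih hS.of_concat
    have hsum := Finset.sum_le_sum fun w (_ : w ∈ Finset.univ) =>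
      node_potential_le hk σ w (S σ.length) hS.mem_support_concat
    have hmiss := Nat.cast_le (α := ℝ).2 (sum_notMem_randomGraph_le k σ e)
    have hfaults : ∀ ω : Order n, (randomGraphAlgorithm hk ω).faults (σ ++ [e]) =
        (randomGraphAlgorithm hk ω).faults σ + if e ∈ randomGraph k ω σ then 0 else 1 :=
      fun ω => GraphAlgorithm.faults_concat _ _ _
    have hcost : scheduleCost S (σ.length + 1) =
        scheduleCost S σ.length + (S σ.length).fetchCost (S (σ.length + 1)) :=
      Finset.sum_range_succ _ _
    have hfetch : ((∑ w, (((S (σ.length + 1)).support \ (S σ.length).support) ∩ star w).card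
        : ℕ) : ℝ) ≤ 2 * (S σ.length).fetchCost (S (σ.length + 1)) := by
      rw [sum_card_inter_star]
      exact_mod_cast Nat.mul_le_mul_left 2 (Cache.card_support_sdiff_le _ _)
    have hL : (0 : ℝ) ≤ Fintype.card (Order n) * (1 + harmonic k) :=
      mul_nonneg (Nat.cast_nonneg _) (add_nonneg zero_le_one (harmonic_cast_nonneg k))
    have hfetch := mul_le_mul_of_nonneg_left hfetch hL
    rw [Finset.sum_add_distrib, ← Finset.mul_sum, ← Finset.mul_sum] at hsum
    simp only [mul_add, Finset.sum_add_distrib, ← Finset.mul_sum] at hsum ih ⊢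
    rw [List.length_append, List.length_singleton, hcost,
      Finset.sum_congr rfl fun ω _ => hfaults ω, Finset.sum_add_distrib]
    push_cast at *
    linarith

theorem expectedCost_randomMarking_le (hk : 1 ≤ k) (σ : List (Edge n)) (S : ℕ → Cache n k)
    (hS : Serves S σ) :
    (randomMarking n hk).expectedCost σ ≤
      n * ((1 + harmonic k) * (4 * scheduleCost S σ.length)) := by
  have hN : (0 : ℝ) < Fintype.card (Order n) := by
    exact_mod_cast Fintype.card_pos
  have hL : (0 : ℝ) ≤ 1 + harmonic k := add_nonneg zero_le_one (harmonic_cast_nonneg k)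
  have hfaults : ((∑ ω : Order n, (randomGraphAlgorithm hk ω).faults σ : ℕ) : ℝ) ≤
      Fintype.card (Order n) * ((1 + harmonic k) * (4 * scheduleCost S σ.length) : ℝ) := by
    refine le_trans (le_add_of_nonneg_right ?_) (sum_faults_add_le hk σ S hS)
    exact mul_nonneg hN.le (Finset.sum_nonneg fun w _ =>
      add_nonneg (markingPotential_nonneg _) (mul_nonneg hL (Nat.cast_nonneg _)))
  have hcost : ∑ ω : Order n, (((randomGraphAlgorithm hk ω).toOnline ⟨0, hk⟩).cost σ : ℝ) ≤
      n * (∑ ω : Order n, (randomGraphAlgorithm hk ω).faults σ : ℕ) := by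
    rw [Nat.cast_sum, Finset.mul_sum]
    exact Finset.sum_le_sum fun ω _ => by
      exact_mod_cast (randomGraphAlgorithm hk ω).cost_toOnline_le ⟨0, hk⟩ σ
  refine le_of_mul_le_mul_left ?_ hN
  rw [card_mul_expectedCost]
  refine (hcost.trans (mul_le_mul_of_nonneg_left hfaults (Nat.cast_nonneg n))).trans_eq ?_
  ring

/-- Combines `harmonic k ≤ 1 + log k` with `1 ≤ logb 2 k`, where `k ≥ 2` enters, and `log k ≤ logb 2
k`, which holds as `log 2 < 1`. -/
theorem one_add_harmonic_le (hk : 2 ≤ k) : (1 + harmonic k : ℝ) ≤ 3 * Real.logb 2 k := by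
  have h2 : (2 : ℝ) ≤ k := by exact_mod_cast hk
  have hlog2 : 0 < Real.log 2 := Real.log_pos one_lt_two
  have hlog : 0 ≤ Real.log k := Real.log_nonneg (one_le_two.trans h2)
  have h1 : 1 ≤ Real.logb 2 k := by
    rw [Real.logb, le_div_iff₀ hlog2, one_mul]
    exact Real.log_le_log two_pos h2
  have h3 : Real.log k ≤ Real.logb 2 k := by
    rw [Real.logb, le_div_iff₀ hlog2]
    have := Real.log_two_lt_d9
    exact mul_le_of_le_one_right hlog (by linarith)
  have := harmonic_le_one_add_log k
  linarith

theorem exists_randomized (n : ℕ) (hk : 2 ≤ k) :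
    ∃ R : RandomizedAlgorithm n k, R.IsCompetitive (12 * ((n : ℝ) * Real.logb 2 (k : ℝ))) := by
  have hk1 : 1 ≤ k := one_le_two.trans hk
  refine ⟨randomMarking n hk1, 0, fun σ => ?_⟩
  obtain ⟨S, hS, hopt⟩ := ((markingGraph n hk1).toOnline ⟨0, hk1⟩).exists_optimal σ
  rw [← hopt, add_zero]
  calc (randomMarking n hk1).expectedCost σ
      ≤ n * ((1 + harmonic k) * (4 * scheduleCost S σ.length)) :=
        expectedCost_randomMarking_le hk1 σ S hS
    _ ≤ n * (3 * Real.logb 2 k * (4 * scheduleCost S σ.length)) := by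
        gcongr
        exact one_add_harmonic_le hk
    _ = 12 * (n * Real.logb 2 k) * scheduleCost S σ.length := by ring

end CachingInMatchings

theorem mainTheorem1 :
    (∀ n k : ℕ, 1 ≤ k →
      ∃ A : CachingInMatchings.OnlineAlgorithm n k, A.IsCompetitive ((n : ℝ) * (k : ℝ))) ∧
    (∃ C : ℝ, 0 < C ∧ ∀ n k : ℕ, 2 ≤ k →
      ∃ R : CachingInMatchings.RandomizedAlgorithm n k,
        R.IsCompetitive (C * ((n : ℝ) * Real.logb 2 (k : ℝ)))) :=
  ⟨fun n _ hk => CachingInMatchings.exists_deterministic n hk,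
    12, by norm_num, fun n _ hk => CachingInMatchings.exists_randomized n hk⟩
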